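/- A finitary matroid on a (possibly infinite) set $E$ is a matroid on $E$ in which a set is independent as soon as all of its finite subsets are independent; its bases are its maximal independent sets. For $X \subseteq E$, let $M{\upharpoonright}X$ be the restriction of $M$ to $X$, and let $N.X := N/(E\setminus X)$ be the matroid on $X$ obtained from $N$ by contracting $E \setminus X$. A set $S\subseteq E$ spans $e\in E$ in $N$ if $e\in S$ or there is a circuit $C$ of $N$ with $e\in C$ and $C\setminus\{e\}\subseteq S$; let $\mathsf{span}_N(S)$ be the set of all elements spanned by $S$ in $N$. **Theorem 3.1.** Let $M$ and $N$ be finitary matroids on a common ground set $E$ that satisfy the matroidal Hall condition $\mathsf{Hall}(M,N)$: for every $X\subseteq E$, if $M{\upharpoonright}X$ has a base that is independent in $N.X$, then $N.X$ has a base that is independent in $M{\upharpoonright}X$. Then $(M,N)$ is finitely matchable: for every finite $F\subseteq E$ there is a set $I$ that is independent in $M$ and satisfies $F\subseteq \mathsf{span}_N(I)$. -/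

import Mathlib

namespace Matroid

/-- The matroid `N.X := N / (E \ X)` obtained from `N` by contracting the complement of `X`.
Its ground set is `X` when `X ⊆ E`. -/
def contractTo {α : Type*} (N : Matroid α) (X : Set α) : Matroid α :=
  N.contract (N.E \ X)

/-- The matroidal Hall condition `Hall(M, N)` for matroids on a common ground set: for every
set `X` of elements, if `M` restricted to `X` has an `N.X`-independent base, then `N.X` has a
base that is independent in `M` restricted to `X`. -/
def HallCondition {α : Type*} (M N : Matroid α) : Prop :=
  ∀ X : Set α, X ⊆ M.E →
    (∃ B : Set α, (M.restrict X).IsBase B ∧ (N.contractTo X).Indep B) →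
      ∃ B : Set α, (N.contractTo X).IsBase B ∧ (M.restrict X).Indep B

/-- `(M, N)` is finitely matchable if every finite set of elements is spanned in `N` by some
set that is independent in `M`. -/
def FinitelyMatchable {α : Type*} (M N : Matroid α) : Prop :=
  ∀ F : Set α, F ⊆ M.E → F.Finite → ∃ I : Set α, M.Indep I ∧ F ⊆ N.closure I

end Matroid

/-!
The proof rests on two notions. Call a set *spannable* if some `M`-independent set spans it in `N`,
and call an `M`-independent set `A` *safe* if no `M`-independent set `J ⊇ A` spans an element
`a ∈ A` in `N` by `J \ {a}`. Intuitively, a safe set is needed to span itself, whatever else is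
used.

Unions of chains of safe sets are safe, so there is a maximal safe set `A`. Let `X` be the
`M`-closure of `A` and `Y` its complement. If some finite subset of `Y` were not spannable in
`((M / A) | Y, N | Y)`, then this pair would have a nonempty safe set (`exists_nonempty_safe`), and
adding it to `A` would contradict maximality (`Safe.union`). So every finite subset of `Y` is
spanned in `N` by some `T ⊆ Y` with `A ∪ T` independent in `M`. Safety of `A` then shows that `A` is
independent in `N.X`, and `A` is a base of `M | X`. Hall's condition provides a base `B` of `N.X`
that is independent in `M | X`. A finite set `F` is spanned in `N` by `B` and a finite subset of
`Y`, hence by `B ∪ T` for a suitable `T`; and `B ∪ T` is `M`-independent because `A ∪ T` is and `A`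
spans `B`.

A nonempty safe set is built when `M` has no loops and a finite set `Z` is not spannable. By Zorn's
lemma one may delete from `M` and contract in `N` a maximal set of elements that keeps `Z`
unspannable; then every single element `e` makes `Z` spannable when added for free. The construction
works with finite common independent sets `I`. The augmentation theorem
`exists_augmentation_or_obstruction`, in the style of matroid intersection, says that if
`insert b I` is not spannable, then some *tight* set `X` through `b` witnesses this: `X` is spanned
in `M` by `I ∩ X`, and outside `X` the set `I \ X` spans in `N` all that `I` spans. If `X` has
minimal trace on `I`, this trace is a finitary approximation of a safe set (`MinTight.robust`). The
union of these traces, the *heart* of `I`, is robust in the same sense and can only grow when `I` is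
replaced by a set that keeps the heart and spans the rest of `I` without it
(`Extends.heart_subset_heart`). Such replacements exist whenever they are not obviously impossible
(`Robust.exists_extension`), and by criticality of `Z` they can be chosen so that the heart spans
any prescribed finite set in `M` (`CommonIndep.exists_extends_subset_closure_heart`). Iterating this
`ω` times, each heart spanning the previous common independent set, gives an increasing sequence of
hearts whose union is safe.
-/

open Set

namespace Matroid

variable {α : Type*} {M N : Matroid α}

/-! ### Closure and independence -/

/-- An element `v` spanned by an independent set `K` but not by `K \ D` needs some `d ∈ D` of its
fundamental circuit, and `d` can be exchanged for `v`. -/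
lemma Indep.exists_notMem_closure_sdiff_singleton {K D : Set α} {v : α} (hK : M.Indep K)
    (hv : v ∈ M.closure K) (hvD : v ∉ M.closure (K \ D)) :
    ∃ d ∈ K, d ∈ D ∧ v ∉ M.closure (K \ {d}) ∧ d ∈ M.closure (insert v (K \ {d})) := by
  by_contra! hcon
  have key : ∀ d ∈ K, d ∈ D → v ∈ M.closure (K \ {d}) := by
    intro d hdK hdD
    by_contra hvd
    refine hcon d hdK hdD hvd (mem_closure_insert hvd ?_)
    rwa [insert_sdiff_singleton, insert_eq_of_mem hdK]
  have hJs := hK.closure_sInter_eq_biInter_closure_of_forall_subset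
    (Js := insert K ((fun d ↦ K \ {d}) '' (K ∩ D))) (insert_nonempty _ _) (by
      rintro J (rfl | ⟨d, -, rfl⟩)
      · exact Subset.rfl
      · exact sdiff_subset)
  refine hvD ?_
  have hmem : v ∈ M.closure (⋂₀ insert K ((fun d ↦ K \ {d}) '' (K ∩ D))) := by
    rw [hJs, mem_iInter₂]
    rintro J (rfl | ⟨d, ⟨hdK, hdD⟩, rfl⟩)
    · exact hv
    · exact key d hdK hdD
  refine M.closure_subset_closure (Y := K \ D) (fun x hx ↦ ?_) hmem
  have hxJ := mem_sInter.1 hx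
  have hxK : x ∈ K := hxJ K (mem_insert _ _)
  exact ⟨hxK, fun hxD ↦ (hxJ (K \ {x}) (mem_insert_of_mem _ ⟨x, ⟨hxK, hxD⟩, rfl⟩)).2 rfl⟩

lemma Indep.union_indep_of_forall_notMem_closure {B T : Set α} (hB : M.Indep B) (hT : T ⊆ M.E)
    (h : ∀ t ∈ T, t ∉ M.closure (B ∪ (T \ {t}))) : M.Indep (B ∪ T) := by
  have hTi : M.Indep T := (indep_iff_forall_notMem_closure_sdiff hT).2 fun t ht htc ↦
    h t ht (M.closure_subset_closure subset_union_right htc)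
  exact (hB.union_indep_iff_forall_notMem_closure_right hTi).2 fun e he ↦ h e he.1

/-- In an independent set `A ∪ T`, the part `A` may be exchanged for any independent set that it
spans. -/
lemma Indep.union_indep_of_subset_closure {A B T : Set α} (h : M.Indep (A ∪ T))
    (hAT : Disjoint A T) (hB : M.Indep B) (hBA : B ⊆ M.closure A) : M.Indep (B ∪ T) := by
  have hg := h.subset_ground
  refine hB.union_indep_of_forall_notMem_closure (subset_union_right.trans hg) fun t ht htc ↦ ?_
  refine h.notMem_closure_sdiff_of_mem (.inr ht) (closure_subset_closure_of_subset_closure ?_ htc)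
  have htA : t ∉ A := fun h' ↦ hAT.le_bot ⟨h', ht⟩
  refine union_subset (hBA.trans (M.closure_subset_closure ?_)) ?_
  · exact subset_sdiff_singleton subset_union_left htA
  · exact M.subset_closure_of_subset' (sdiff_subset_sdiff_left subset_union_right)
      (sdiff_subset.trans (subset_union_right.trans hg))

lemma Indep.encard_le_encard_of_subset_closure {I J : Set α} (hI : M.Indep I)
    (h : I ⊆ M.closure J) : I.encard ≤ J.encard :=
  (hI.encard_le_eRk_of_subset h).trans ((M.eRk_closure_eq J).trans_le (M.eRk_le_encard J))

lemma Indep.ncard_le_ncard_of_subset_closure {I J : Set α} (hI : M.Indep I) (hJ : J.Finite)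
    (h : I ⊆ M.closure J) : I.ncard ≤ J.ncard :=
  ENat.toNat_le_toNat (hI.encard_le_encard_of_subset_closure h) hJ.encard_lt_top.ne

/-! ### Augmenting a common independent set -/

/-- Let `I` be independent over `P` in `M` and over `Q` in `N`. Either `I` can be replaced by a set
of the same kind that over `Q` also spans `s` in `N`, or there is an obstruction: a set `X`
containing `s` that is spanned in `M` by `I ∩ X` over `P`, and such that every element outside `X`
that `I` spans in `N` over `Q` is already spanned by `I \ X` over `Q`. -/
theorem exists_augmentation_or_obstruction (hE : M.E = N.E) {I : Set α} (hI : I.Finite) :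
    ∀ {P Q : Set α} {s : α}, Disjoint I P → Disjoint I Q → M.Indep (I ∪ P) → N.Indep (I ∪ Q) →
    s ∈ N.E → s ∉ N.closure (I ∪ Q) →
    (∃ J : Set α, J.Finite ∧ Disjoint J P ∧ Disjoint J Q ∧ M.Indep (J ∪ P) ∧ N.Indep (J ∪ Q) ∧
      insert s I ⊆ N.closure (J ∪ Q) ∧ J ⊆ N.closure (insert s I ∪ Q)) ∨
    ∃ X : Set α, s ∈ X ∧ X ⊆ M.closure ((I ∩ X) ∪ P) ∧
      ∀ v ∈ N.closure (I ∪ Q), v ∉ X → v ∈ N.closure ((I \ X) ∪ Q) := by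
  induction hn : I.ncard generalizing I with
  | zero =>
    intro P Q s hIP hIQ hM hN hsE hs
    obtain rfl : I = ∅ := (ncard_eq_zero hI).1 hn
    rw [empty_union] at *
    have hsQ : s ∉ Q := fun h ↦ hs (N.mem_closure_of_mem' h hsE)
    by_cases hsP : s ∈ M.closure P
    · exact .inr ⟨{s}, rfl, by simpa, by simp +contextual⟩
    · have hsP' : s ∉ P := fun h ↦ hsP (M.mem_closure_of_mem' h (hE ▸ hsE))
      refine .inl ⟨{s}, finite_singleton s, by simpa, by simpa, ?_, ?_, ?_, ?_⟩
      · rw [singleton_union]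
        exact (hM.notMem_closure_iff_of_notMem hsP' (hE ▸ hsE)).1 hsP
      · rw [singleton_union]
        exact (hN.notMem_closure_iff_of_notMem hsQ hsE).1 hs
      · simpa using N.mem_closure_of_mem' (.inl rfl : s ∈ {s} ∪ Q) hsE
      · simpa using N.mem_closure_of_mem' (.inl rfl : s ∈ {s} ∪ Q) hsE
  | succ n ih =>
    intro P Q s hIP hIQ hM hN hsE hs
    have hsIQ : s ∉ I ∪ Q := fun h ↦ hs (N.mem_closure_of_mem' h hsE)
    have hNs : N.Indep (insert s (I ∪ Q)) := (hN.notMem_closure_iff_of_notMem hsIQ hsE).1 hs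
    have hsI : s ∉ I := fun h ↦ hsIQ (.inl h)
    have hsQ : s ∉ Q := fun h ↦ hsIQ (.inr h)
    by_cases hsP : s ∈ M.closure P
    · refine .inr ⟨{s}, rfl, ?_, fun v hv hvs ↦ ?_⟩
      · rw [singleton_subset_iff]
        exact M.closure_subset_closure subset_union_right hsP
      · rwa [sdiff_singleton_eq_self hsI]
    have hsP' : s ∉ P := fun h ↦ hsP (M.mem_closure_of_mem' h (hE ▸ hsE))
    by_cases hsIP : s ∈ M.closure (I ∪ P)
    swap
    · refine .inl ⟨insert s I, hI.insert s, ?_, ?_, ?_, ?_, ?_, ?_⟩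
      · exact disjoint_insert_left.2 ⟨hsP', hIP⟩
      · exact disjoint_insert_left.2 ⟨hsQ, hIQ⟩
      · rw [insert_union]
        exact (hM.notMem_closure_iff_of_notMem (by simp [hsI, hsP']) (hE ▸ hsE)).1 hsIP
      · rwa [insert_union]
      all_goals
        refine N.subset_closure_of_subset' subset_union_left (insert_subset hsE ?_)
        exact subset_union_left.trans hN.subset_ground
    -- An element `y` of the fundamental circuit of `s`; it is moved out of `I`, and `s` into both
    -- `P` and `Q`.
    obtain ⟨y, hy, hyI, hsy, hys⟩ := hM.exists_notMem_closure_sdiff_singleton hsIP (D := I)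
      (fun h ↦ hsP (M.closure_subset_closure (fun x hx ↦ hx.1.resolve_left hx.2) h))
    have hyP : y ∉ P := fun h ↦ hIP.le_bot ⟨hyI, h⟩
    have hyQ : y ∉ Q := fun h ↦ hIQ.le_bot ⟨hyI, h⟩
    have hdP : (I ∪ P) \ {y} = (I \ {y}) ∪ P := by
      rw [union_sdiff_distrib, sdiff_singleton_eq_self hyP]
    have hdQ : (I ∪ Q) \ {y} = (I \ {y}) ∪ Q := by
      rw [union_sdiff_distrib, sdiff_singleton_eq_self hyQ]
    rw [hdP] at hsy hys
    have hsy_ne : s ≠ y := fun h ↦ hsI (h ▸ hyI)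
    have hM' : M.Indep ((I \ {y}) ∪ insert s P) := by
      rw [union_insert]
      refine ((hM.subset (union_subset_union_left _ sdiff_subset)).notMem_closure_iff_of_notMem
        (by simp [hsI, hsP']) (hE ▸ hsE)).1 hsy
    have hN' : N.Indep ((I \ {y}) ∪ insert s Q) := by
      rw [union_insert]
      exact hNs.subset (insert_subset_insert (union_subset_union_left _ sdiff_subset))
    have hcard : (I \ {y}).ncard = n := by
      rw [ncard_sdiff_singleton_of_mem hyI, hn]; rfl
    have hyS : y ∉ N.closure ((I \ {y}) ∪ insert s Q) := by
      have := hNs.notMem_closure_sdiff_of_mem (.inr (.inl hyI) : y ∈ insert s (I ∪ Q))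
      rwa [← insert_sdiff_singleton_comm hsy_ne, hdQ, ← union_insert] at this
    have hyN : y ∈ N.closure (I ∪ Q) :=
      N.mem_closure_of_mem (.inl hyI) hN.subset_ground
    have hIH := fun z (hz : z ∈ N.closure (I ∪ Q))
      (hz' : z ∉ N.closure ((I \ {y}) ∪ insert s Q)) ↦
      ih (I := I \ {y}) hI.sdiff hcard (P := insert s P) (Q := insert s Q) (s := z)
        (disjoint_insert_right.2 ⟨fun h ↦ hsI h.1, hIP.mono_left sdiff_subset⟩)
        (disjoint_insert_right.2 ⟨fun h ↦ hsI h.1, hIQ.mono_left sdiff_subset⟩) hM' hN'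
        (N.closure_subset_ground _ hz) hz'
    by_cases haug : ∃ z, z ∈ N.closure (I ∪ Q) ∧ z ∉ N.closure ((I \ {y}) ∪ insert s Q) ∧
      ∃ J : Set α, J.Finite ∧ Disjoint J (insert s P) ∧ Disjoint J (insert s Q) ∧
        M.Indep (J ∪ insert s P) ∧ N.Indep (J ∪ insert s Q) ∧
        insert z (I \ {y}) ⊆ N.closure (J ∪ insert s Q) ∧
        J ⊆ N.closure (insert z (I \ {y}) ∪ insert s Q)
    · obtain ⟨z, hz, hz', J, hJfin, hJP, hJQ, hJM, hJN, hzJ, hJz⟩ := haug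
      rw [disjoint_insert_right] at hJP hJQ
      have hJs : ∀ R : Set α, insert s J ∪ R = J ∪ insert s R := fun R ↦ by
        rw [insert_union, union_insert]
      refine .inl ⟨insert s J, hJfin.insert s, disjoint_insert_left.2 ⟨hsP', hJP.2⟩,
        disjoint_insert_left.2 ⟨hsQ, hJQ.2⟩, by rwa [hJs], by rwa [hJs], ?_, ?_⟩
      · rw [hJs]
        have hsub : (I \ {y}) ∪ insert s Q ⊆ N.closure (J ∪ insert s Q) :=
          union_subset ((subset_insert _ _).trans hzJ)
            (N.subset_closure_of_subset' subset_union_right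
              (subset_union_right.trans hJN.subset_ground))
        refine insert_subset (hsub (.inr (.inl rfl))) fun x hx ↦ ?_
        obtain rfl | hxy := eq_or_ne x y
        · have hzc : z ∈ N.closure (insert x ((I \ {x}) ∪ insert s Q)) := by
            refine N.closure_subset_closure ?_ hz
            rw [← insert_union, insert_sdiff_singleton]
            exact union_subset_union (subset_insert _ _) (subset_insert _ _)
          refine closure_subset_closure_of_subset_closure (insert_subset ?_ hsub)
            (mem_closure_insert hz' hzc)
          exact hzJ (mem_insert _ _)
        · exact hsub (.inl ⟨hx, hxy⟩)
      · have hg : insert s I ∪ Q ⊆ N.E := by rw [insert_union]; exact hNs.subset_ground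
        refine insert_subset (N.mem_closure_of_mem (.inl (mem_insert _ _)) hg) (hJz.trans
          (closure_subset_closure_of_subset_closure ?_))
        refine union_subset (insert_subset ?_ ?_) (insert_subset ?_ ?_)
        · exact N.closure_subset_closure (union_subset_union_left _ (subset_insert _ _)) hz
        · exact N.subset_closure_of_subset
            (sdiff_subset.trans ((subset_insert _ _).trans subset_union_left)) hg
        · exact N.mem_closure_of_mem (.inl (mem_insert _ _)) hg
        · exact N.subset_closure_of_subset subset_union_right hg
    have hobs : ∀ z : α, ∃ X : Set α, z ∈ N.closure (I ∪ Q) →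
        z ∉ N.closure ((I \ {y}) ∪ insert s Q) →
        z ∈ X ∧ X ⊆ M.closure (((I \ {y}) ∩ X) ∪ insert s P) ∧
        ∀ v ∈ N.closure ((I \ {y}) ∪ insert s Q), v ∉ X →
          v ∈ N.closure (((I \ {y}) \ X) ∪ insert s Q) := by
      intro z
      by_cases hz : z ∈ N.closure (I ∪ Q) ∧ z ∉ N.closure ((I \ {y}) ∪ insert s Q)
      · obtain h | ⟨X, hX⟩ := hIH z hz.1 hz.2
        · exact absurd ⟨z, hz.1, hz.2, h⟩ haug
        · exact ⟨X, fun _ _ ↦ hX⟩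
      · exact ⟨∅, fun h1 h2 ↦ absurd ⟨h1, h2⟩ hz⟩
    choose X hX using hobs
    set S := {z | z ∈ N.closure (I ∪ Q) ∧ z ∉ N.closure ((I \ {y}) ∪ insert s Q)} with hS
    set U := insert s (⋃ z ∈ S, X z) with hU
    have hXU : ∀ z ∈ S, X z ⊆ U := fun z hz ↦
      (subset_biUnion_of_mem (u := X) hz).trans (subset_insert _ _)
    have hyX : y ∈ X y := (hX y hyN hyS).1
    have hyU : y ∈ U := hXU y ⟨hyN, hyS⟩ hyX
    have hg : I ∩ U ∪ P ⊆ M.E :=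
      (union_subset_union_left _ inter_subset_left).trans hM.subset_ground
    have hsU : s ∈ M.closure (I ∩ U ∪ P) := by
      have h1 := (hX y hyN hyS).2.1 hyX
      rw [union_insert] at h1
      have h2 : y ∉ M.closure ((I \ {y}) ∩ X y ∪ P) := by
        have := hM.notMem_closure_sdiff_of_mem (.inl hyI : y ∈ I ∪ P)
        rw [hdP] at this
        exact fun h ↦ this (M.closure_subset_closure
          (union_subset_union_left _ inter_subset_left) h)
      refine M.closure_subset_closure ?_ (mem_closure_insert h2 h1)
      exact insert_subset (.inl ⟨hyI, hyU⟩) (union_subset_union_left _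
        (inter_subset_inter sdiff_subset (hXU y ⟨hyN, hyS⟩)))
    refine .inr ⟨U, mem_insert _ _, insert_subset hsU ?_, fun v hv hvU ↦ ?_⟩
    · refine iUnion₂_subset fun z hz ↦ (hX z hz.1 hz.2).2.1.trans
        (closure_subset_closure_of_subset_closure ?_)
      refine union_subset ?_ (insert_subset hsU (M.subset_closure_of_subset subset_union_right hg))
      exact (inter_subset_inter sdiff_subset (hXU z hz)).trans
        (M.subset_closure_of_subset subset_union_left hg)
    by_contra hvn
    obtain ⟨d, hd, hdU, hvd, hdv⟩ := hN.exists_notMem_closure_sdiff_singleton hv (D := I ∩ U)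
      (fun h ↦ hvn (N.closure_subset_closure (by
        rintro x ⟨hx | hx, hxU⟩
        · exact .inl ⟨hx, fun h ↦ hxU ⟨hx, h⟩⟩
        · exact .inr hx) h))
    have hvS : v ∈ N.closure ((I \ {y}) ∪ insert s Q) := by
      by_contra hvS
      exact hvU (hXU v ⟨hv, hvS⟩ (hX v hv hvS).1)
    have hdQ' : (I ∪ Q) \ {d} = (I \ {d}) ∪ Q := by
      rw [union_sdiff_distrib, sdiff_singleton_eq_self (fun h ↦ hIQ.le_bot ⟨hdU.1, h⟩)]
    -- Spanning `v` with the help of `s` but without `d` would put `s` into the closure of `I ∪ Q`.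
    have hcl : v ∉ N.closure (insert s ((I ∪ Q) \ {d})) := by
      intro h
      refine hs (closure_subset_closure_of_subset_closure (insert_subset hv ?_)
        (mem_closure_insert hvd h))
      exact N.subset_closure_of_subset sdiff_subset hN.subset_ground
    obtain hds | hdX := hdU.2
    · exact hsI (hds ▸ hdU.1)
    rw [mem_iUnion₂] at hdX
    obtain ⟨z, hz, hdz⟩ := hdX
    by_cases hdy : d = y
    · subst hdy
      rw [hdQ, ← union_insert] at hcl
      exact hcl hvS
    refine hcl ?_
    rw [hdQ', ← union_insert]
    refine N.closure_subset_closure (union_subset_union_left _ ?_)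
      ((hX z hz.1 hz.2).2.2 v hvS fun h ↦ hvU (hXU z hz h))
    rintro x ⟨hx, hxz⟩
    exact ⟨hx.1, fun h ↦ hxz (h ▸ hdz)⟩

/-! ### Tight sets -/

/-- `S` is spanned in `N` by some `M`-independent set. -/
def Spannable (M N : Matroid α) (S : Set α) : Prop :=
  ∃ J, M.Indep J ∧ S ⊆ N.closure J

/-- `I` is a finite common independent set of `M` and `N`. -/
structure CommonIndep (M N : Matroid α) (I : Set α) : Prop where
  finite : I.Finite
  left : M.Indep I
  right : N.Indep I

/-- `X` is tight for `I` if `I ∩ X` spans `X` in `M`, and `I \ X` spans in `N` whatever part of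
`N.closure I` lies outside `X`. -/
structure Tight (M N : Matroid α) (I X : Set α) : Prop where
  left : X ⊆ M.closure (I ∩ X)
  right : ∀ v ∈ N.closure I, v ∉ X → v ∈ N.closure (I \ X)

/-- `X` is a tight set for `I` that contains `b` and has no tight subset with these properties whose
trace on `I` is smaller. -/
structure MinTight (M N : Matroid α) (I : Set α) (b : α) (X : Set α) : Prop where
  tight : Tight M N I X
  mem : b ∈ X
  minimal : ∀ Y, Tight M N I Y → b ∈ Y → Y ⊆ X → I ∩ X ⊆ Y

lemma exists_forall_le_of_bounded {β : Type*} {p : β → Prop} (f : β → ℕ) (k : ℕ)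
    (hf : ∀ x, p x → f x ≤ k) (h : ∃ x, p x) : ∃ x, p x ∧ ∀ y, p y → f y ≤ f x := by
  obtain ⟨x, hx, hmin⟩ := (measure fun x ↦ k - f x).wf.has_min {x | p x} h
  refine ⟨x, hx, fun y hy ↦ ?_⟩
  have h1 : ¬ (k - f y < k - f x) := hmin y hy
  have := hf y hy
  omega

lemma Spannable.mono {S T : Set α} (h : Spannable M N T) (hST : S ⊆ N.closure T) :
    Spannable M N S := by
  obtain ⟨J, hJ, hTJ⟩ := h
  exact ⟨J, hJ, hST.trans (closure_subset_closure_of_subset_closure hTJ)⟩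

lemma Tight.sUnion {I : Set α} {F : Set (Set α)} (hI : N.Indep I)
    (h : ∀ X ∈ F, Tight M N I X) : Tight M N I (⋃₀ F) := by
  refine ⟨sUnion_subset fun X hX ↦ (h X hX).left.trans (M.closure_subset_closure
    (inter_subset_inter_right _ (subset_sUnion_of_mem hX))), fun v hv hvF ↦ ?_⟩
  by_contra hvn
  obtain ⟨d, hdI, hdF, hvd, -⟩ := hI.exists_notMem_closure_sdiff_singleton hv hvn
  obtain ⟨X, hX, hdX⟩ := mem_sUnion.1 hdF
  refine hvd (N.closure_subset_closure ?_
    ((h X hX).right v hv fun h' ↦ hvF (mem_sUnion.2 ⟨X, hX, h'⟩)))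
  exact fun x hx ↦ ⟨hx.1, fun h' ↦ hx.2 (h' ▸ hdX)⟩

/-- If `insert b I` is not spannable, then there is a tight set through `b`: augmenting `I` by `b`
would span `insert b I`. -/
lemma CommonIndep.exists_minTight {I : Set α} {b : α} (hE : M.E = N.E) (hI : CommonIndep M N I)
    (hb : b ∈ M.E) (hbI : ¬ Spannable M N (insert b I)) : ∃ X, MinTight M N I b X := by
  have hne : ∃ X, Tight M N I X ∧ b ∈ X := by
    have hbcl : b ∉ N.closure I := fun h ↦ hbI ⟨I, hI.left, insert_subset h
      (N.subset_closure I hI.right.subset_ground)⟩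
    obtain ⟨J, -, -, -, hJ, -, hJc, -⟩ | ⟨X, hbX, hX, hXN⟩ :=
      exists_augmentation_or_obstruction (M := M) (N := N) (P := ∅) (Q := ∅) (s := b) hE hI.finite
        (disjoint_empty _) (disjoint_empty _) (by simpa using hI.left) (by simpa using hI.right)
        (hE ▸ hb) (by simpa using hbcl)
    · simp only [union_empty] at hJ hJc
      exact absurd ⟨J, hJ, hJc⟩ hbI
    · simp only [union_empty] at hX hXN
      exact ⟨X, ⟨hX, hXN⟩, hbX⟩
  obtain ⟨X, hX, hmin⟩ := (measure fun X : Set α ↦ (I ∩ X).ncard).wf.has_min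
    {X | Tight M N I X ∧ b ∈ X} hne
  refine ⟨X, hX.1, hX.2, fun Y hY hbY hYX ↦ ?_⟩
  have h1 : ¬ ((I ∩ Y).ncard < (I ∩ X).ncard) := hmin Y ⟨hY, hbY⟩
  rw [← eq_of_subset_of_ncard_le (inter_subset_inter_right I hYX) (not_lt.1 h1)
    (hI.finite.inter_of_left X)]
  exact inter_subset_right

/-- The intersection of tight sets in the generality needed: a tight set for `I` can be intersected with an obstruction `X'` for another set `K`, relative
to `P` and `Q`, provided that `K ∪ Q` spans `I` in `N` in a way compatible with `I ∩ X`. -/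
lemma Tight.inter_obstruction {I X X' K P Q : Set α} (hX : Tight M N I X) (hI : N.Indep I)
    (hM : M.Indep ((I ∩ X) ∪ (K ∪ P))) (hN : N.Indep (K ∪ Q)) (hP : Disjoint (I ∩ X) P)
    (hQ : Disjoint (I ∩ X) Q) (hX'M : X' ⊆ M.closure ((K ∩ X') ∪ P))
    (hX'N : ∀ v ∈ N.closure (K ∪ Q), v ∉ X' → v ∈ N.closure ((K \ X') ∪ Q))
    (hIK : I ⊆ N.closure (K ∪ Q)) (hIX : I \ X ⊆ N.closure ((K ∪ Q) \ (I ∩ X))) :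
    Tight M N I (X ∩ X') ∧ I ∩ X ∩ X' ⊆ K := by
  have hcl : X ∩ X' ⊆ M.closure (I ∩ X ∩ (K ∩ X')) := by
    rintro x ⟨hx, hx'⟩
    have hind : M.Indep ((I ∩ X) ∪ ((K ∩ X') ∪ P)) :=
      hM.subset (union_subset_union_right _ (union_subset_union_left _ inter_subset_left))
    have hx2 : x ∈ M.closure ((I ∩ X) ∩ ((K ∩ X') ∪ P)) := by
      rw [hind.closure_inter_eq_inter_closure]
      exact ⟨hX.left hx, hX'M hx'⟩
    refine M.closure_subset_closure ?_ hx2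
    exact fun y hy ↦ ⟨hy.1, hy.2.resolve_right fun h ↦ hP.le_bot ⟨hy.1, h⟩⟩
  have hK : I ∩ X ∩ X' ⊆ K := by
    intro x hx
    by_contra hxK
    refine (hM.subset subset_union_left).notMem_closure_sdiff_of_mem hx.1
      (M.closure_subset_closure ?_ (hcl ⟨hx.1.2, hx.2⟩))
    exact fun y hy ↦ ⟨hy.1, fun h ↦ hxK (h ▸ hy.2.1)⟩
  refine ⟨⟨hcl.trans (M.closure_subset_closure fun y hy ↦ ⟨hy.1.1, hy.1.2, hy.2.2⟩),
    fun v hv hvX ↦ ?_⟩, hK⟩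
  by_cases hvX1 : v ∉ X
  · exact N.closure_subset_closure (sdiff_subset_sdiff_right inter_subset_left)
      (hX.right v hv hvX1)
  have hvX' : v ∉ X' := fun h ↦ hvX ⟨not_not.1 hvX1, h⟩
  by_contra hvn
  obtain ⟨a, haI, haX, -, hav⟩ := hI.exists_notMem_closure_sdiff_singleton hv hvn
  have haK : a ∈ K := hK ⟨⟨haI, haX.1⟩, haX.2⟩
  have hsub : (K \ X') ∪ Q ⊆ (K ∪ Q) \ {a} := by
    rintro x (hx | hx)
    · exact ⟨.inl hx.1, fun h ↦ hx.2 (h ▸ haX.2)⟩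
    · exact ⟨.inr hx, fun h ↦ hQ.le_bot ⟨⟨haI, haX.1⟩, h ▸ hx⟩⟩
  -- Outside `X'`, whatever `K ∪ Q` spans in `N` is spanned without `a`.
  have hout : ∀ x ∈ N.closure I, x ∉ X' → x ∈ N.closure ((K ∪ Q) \ {a}) := fun x hx hxX' ↦
    N.closure_subset_closure hsub (hX'N x (closure_subset_closure_of_subset_closure hIK hx) hxX')
  refine hN.notMem_closure_sdiff_of_mem (.inl haK) (closure_subset_closure_of_subset_closure
    (insert_subset (hout v hv hvX') ?_) hav)
  rintro x ⟨hxI, hxa⟩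
  by_cases hxX : x ∈ X
  · by_cases hxX' : x ∈ X'
    · exact N.mem_closure_of_mem' ⟨.inl (hK ⟨⟨hxI, hxX⟩, hxX'⟩), hxa⟩
        (hI.subset_ground hxI)
    · exact hout x (N.mem_closure_of_mem' hxI (hI.subset_ground hxI)) hxX'
  · refine N.closure_subset_closure (sdiff_subset_sdiff_right ?_) (hIX ⟨hxI, hxX⟩)
    exact singleton_subset_iff.2 ⟨haI, haX.1⟩

/-! ### Robust subsets of a common independent set -/

/-- A part `A` of `I` is robust if no finite `M`-independent set that extends `A`, and that still
spans `I \ A` in `N` without using `A`, spans any `a ∈ A` in `N` without using `a`. -/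
def Robust (M N : Matroid α) (A I : Set α) : Prop :=
  ∀ J, J.Finite → M.Indep J → A ⊆ J → I \ A ⊆ N.closure (J \ A) → ∀ a ∈ A, a ∉ N.closure (J \ {a})

lemma Robust.sUnion {I : Set α} {F : Set (Set α)} (hE : M.E = N.E)
    (h : ∀ X ∈ F, Robust M N (I ∩ X) I) : Robust M N (I ∩ ⋃₀ F) I := by
  rintro J hJfin hJ hAJ hIJ a ⟨haI, haF⟩
  obtain ⟨X, hX, haX⟩ := mem_sUnion.1 haF
  have hXF : I ∩ X ⊆ I ∩ ⋃₀ F := inter_subset_inter_right _ (subset_sUnion_of_mem hX)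
  refine h X hX J hJfin hJ (hXF.trans hAJ) (fun i hi ↦ ?_) a ⟨haI, haX⟩
  by_cases hiF : i ∈ ⋃₀ F
  · have hiJ := hAJ ⟨hi.1, hiF⟩
    exact N.mem_closure_of_mem' ⟨hiJ, hi.2⟩ (hE ▸ hJ.subset_ground hiJ)
  · exact N.closure_subset_closure (sdiff_subset_sdiff_right hXF)
      (hIJ ⟨hi.1, fun h ↦ hiF h.2⟩)

/-- If `insert b I` cannot be spanned, the trace on `I` of a minimal tight set through `b` is
robust. -/
lemma MinTight.robust {I X : Set α} {b : α} (hE : M.E = N.E) (hX : MinTight M N I b X)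
    (hI : CommonIndep M N I) (hb : b ∈ M.E) (hbI : ¬ Spannable M N (insert b I)) :
    Robust M N (I ∩ X) I := by
  intro J hJfin hJ hAJ hIJ a ha haJ
  set A := I ∩ X with hA
  have hJE : J ⊆ N.E := hE ▸ hJ.subset_ground
  obtain ⟨T₀, hT₀⟩ := N.exists_isBasis (J \ A) (sdiff_subset.trans hJE)
  obtain ⟨B, hB, hT₀B⟩ := hT₀.indep.subset_isBasis_of_subset
    (hT₀.subset.trans (sdiff_subset_sdiff_right (singleton_subset_iff.2 ha)))
    (sdiff_subset.trans hJE : J \ {a} ⊆ N.E)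
  have hJB : J ⊆ N.closure B := by
    rw [hB.closure_eq_closure]
    intro x hx
    by_cases hxa : x = a
    · exact hxa ▸ haJ
    · exact N.mem_closure_of_mem' ⟨hx, hxa⟩ (hJE hx)
  -- `B` splits into its part `B ∩ A`, which avoids `a`, and its part `T₀` outside `A`.
  have hBT : B \ A ⊆ T₀ := by
    intro x hx
    by_contra hxT
    have hxcl : x ∈ N.closure T₀ := by
      rw [hT₀.closure_eq_closure]
      exact N.mem_closure_of_mem' ⟨(hB.subset hx.1).1, hx.2⟩ (hB.indep.subset_ground hx.1)
    refine hB.indep.notMem_closure_sdiff_of_mem hx.1 (N.closure_subset_closure ?_ hxcl)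
    exact subset_sdiff_singleton hT₀B hxT
  have hT₀A : Disjoint A T₀ := disjoint_left.2 fun x hx hxT ↦ (hT₀.subset hxT).2 hx
  have hBeq : (B ∩ A) ∪ T₀ = B := by
    refine (union_subset inter_subset_left hT₀B).antisymm fun x hx ↦ ?_
    by_cases hxA : x ∈ A
    · exact .inl ⟨hx, hxA⟩
    · exact .inr (hBT ⟨hx, hxA⟩)
  have haB : a ∉ B := fun h ↦ (hB.subset h).2 rfl
  have hIB : I ⊆ N.closure B := by
    intro x hx
    by_cases hxA : x ∈ A
    · exact hJB (hAJ hxA)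
    · exact closure_subset_closure_of_subset_closure (sdiff_subset.trans hJB) (hIJ ⟨hx, hxA⟩)
  have hBJ : B ⊆ J := hB.subset.trans sdiff_subset
  have hbB : b ∉ N.closure B := fun h ↦ hbI ⟨B, hJ.subset hBJ, insert_subset h hIB⟩
  have hJeq : B ∩ A ∪ J \ A ⊆ J := union_subset (inter_subset_left.trans hBJ) sdiff_subset
  obtain ⟨J', -, -, -, hJ', -, hJc, -⟩ | ⟨X', hbX, hXM, hXN⟩ :=
    exists_augmentation_or_obstruction (M := M) (N := N) (I := B ∩ A) (P := J \ A) (Q := T₀)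
      (s := b) hE (hJfin.subset (inter_subset_left.trans hBJ))
      (disjoint_left.2 fun x hx h ↦ h.2 hx.2) (hT₀A.mono_left inter_subset_right)
      (hJ.subset hJeq) (by rw [hBeq]; exact hB.indep) (hE ▸ hb) (by rwa [hBeq])
  · refine hbI ⟨J' ∪ (J \ A), hJ', ?_⟩
    have h1 : B ⊆ N.closure (J' ∪ (J \ A)) := by
      nth_rw 1 [← hBeq]
      refine union_subset ((subset_insert _ _).trans (hJc.trans (N.closure_subset_closure
        (union_subset_union_right _ hT₀.subset)))) ?_
      exact N.subset_closure_of_subset' (hT₀.subset.trans subset_union_right)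
        hT₀.indep.subset_ground
    refine insert_subset ?_ (hIB.trans (closure_subset_closure_of_subset_closure h1))
    exact N.closure_subset_closure (union_subset_union_right _ hT₀.subset) (hJc (mem_insert _ _))
  · have hAeq : A ∪ (B ∩ A ∪ J \ A) ⊆ J := union_subset hAJ hJeq
    obtain ⟨htight, hsub⟩ := hX.tight.inter_obstruction (K := B ∩ A) (P := J \ A) (Q := T₀)
      (X' := X') hI.right (hJ.subset hAeq) (by rw [hBeq]; exact hB.indep)
      (disjoint_left.2 fun x hx h ↦ h.2 hx) hT₀A hXM hXN (by rwa [hBeq])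
      (fun x hx ↦ by
        rw [hBeq]
        refine N.closure_subset_closure (subset_sdiff.2 ⟨hT₀B, hT₀A.symm⟩) ?_
        rw [hT₀.closure_eq_closure]
        exact hIJ ⟨hx.1, fun h ↦ hx.2 h.2⟩)
    have haX' : a ∈ X' := (hX.minimal _ htight ⟨hX.mem, hbX⟩ inter_subset_left ha).2
    exact haB (hsub ⟨ha, haX'⟩).1

/-! ### Extending a common independent set without damaging its heart -/

/-- The union of all minimal tight sets for `I` through elements `b` such that `insert b I` is
not spannable. -/
def obstruction (M N : Matroid α) (I : Set α) : Set α :=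
  ⋃₀ {X | ∃ b ∈ M.E, ¬ Spannable M N (insert b I) ∧ MinTight M N I b X}

/-- The part of `I` inside its obstruction. -/
def heart (M N : Matroid α) (I : Set α) : Set α :=
  I ∩ obstruction M N I

/-- `I'` contains the heart of `I`, and its remaining part spans the remaining part of `I` in `N`. -/
structure Extends (M N : Matroid α) (I I' : Set α) : Prop where
  heart_subset : heart M N I ⊆ I'
  sdiff_subset : I \ heart M N I ⊆ N.closure (I' \ heart M N I)

lemma heart_subset {I : Set α} : heart M N I ⊆ I :=
  inter_subset_left

lemma CommonIndep.tight_obstruction {I : Set α} (hI : CommonIndep M N I) :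
    Tight M N I (obstruction M N I) :=
  Tight.sUnion hI.right fun _ ⟨_, _, _, hX⟩ ↦ hX.tight

lemma CommonIndep.obstruction_subset {I : Set α} (hI : CommonIndep M N I) :
    obstruction M N I ⊆ M.closure (heart M N I) :=
  hI.tight_obstruction.left

lemma CommonIndep.mem_obstruction {I : Set α} {b : α} (hE : M.E = N.E) (hI : CommonIndep M N I)
    (hb : b ∈ M.E) (hbI : ¬ Spannable M N (insert b I)) : b ∈ obstruction M N I := by
  obtain ⟨X, hX⟩ := hI.exists_minTight hE hb hbI
  exact mem_sUnion.2 ⟨X, ⟨b, hb, hbI, hX⟩, hX.mem⟩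

lemma CommonIndep.robust_heart {I : Set α} (hE : M.E = N.E) (hI : CommonIndep M N I) :
    Robust M N (heart M N I) I :=
  Robust.sUnion hE fun _ ⟨_, hb, hbI, hX⟩ ↦ hX.robust hE hI hb hbI

lemma CommonIndep.extends_refl {I : Set α} (hI : CommonIndep M N I) : Extends M N I I :=
  ⟨heart_subset, N.subset_closure _ (Set.sdiff_subset.trans hI.right.subset_ground)⟩

lemma Extends.subset_closure {I I' : Set α} (h : Extends M N I I') (hI : CommonIndep M N I) :
    I ⊆ N.closure I' := by
  intro x hx
  by_cases hxI : x ∈ heart M N I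
  · exact N.mem_closure_of_mem' (h.heart_subset hxI) (hI.right.subset_ground hx)
  · exact N.closure_subset_closure Set.sdiff_subset (h.sdiff_subset ⟨hx, hxI⟩)

/-- Elements `b` for which `insert b I` is not spannable keep this property for `I'`, and
intersecting a minimal tight set for `I` through `b` with a tight set for `I'` through `b` shows
that the trace of the former is contained in the latter. -/
lemma Extends.heart_subset_heart {I I' : Set α} (hE : M.E = N.E) (h : Extends M N I I')
    (hI : CommonIndep M N I) (hI' : CommonIndep M N I') : heart M N I ⊆ heart M N I' := by
  rintro a ⟨haI, haX⟩
  obtain ⟨X, ⟨b, hb, hbI, hX⟩, haX⟩ := mem_sUnion.1 haX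
  have hsub : I ∩ X ⊆ heart M N I :=
    inter_subset_inter_right _ (subset_sUnion_of_mem ⟨b, hb, hbI, hX⟩)
  have hII' := h.subset_closure hI
  have hbI' : ¬ Spannable M N (insert b I') := fun hs ↦ hbI (hs.mono (insert_subset
    (N.mem_closure_of_mem' (mem_insert _ _) (hE ▸ hb))
    (hII'.trans (N.closure_subset_closure (subset_insert _ _)))))
  obtain ⟨X', hX'⟩ := hI'.exists_minTight hE hb hbI'
  have hIX' := hsub.trans h.heart_subset
  obtain ⟨htight, -⟩ := hX.tight.inter_obstruction (K := I') (P := ∅) (Q := ∅) (X' := X') hI.right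
    (by rw [union_empty, union_eq_self_of_subset_left hIX']; exact hI'.left)
    (by rw [union_empty]; exact hI'.right) (disjoint_empty _) (disjoint_empty _)
    (by rw [union_empty]; exact hX'.tight.left)
    (by simp only [union_empty]; exact hX'.tight.right) (by rwa [union_empty])
    (by
      rw [union_empty]
      intro x hx
      by_cases hxI : x ∈ heart M N I
      · exact N.mem_closure_of_mem' ⟨h.heart_subset hxI, fun h ↦ hx.2 h.2⟩
          (hI.right.subset_ground hx.1)
      · exact N.closure_subset_closure (sdiff_subset_sdiff_right hsub)
          (h.sdiff_subset ⟨hx.1, hxI⟩))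
  refine ⟨h.heart_subset (hsub ⟨haI, haX⟩), mem_sUnion.2 ⟨X', ⟨b, hb, hbI', hX'⟩, ?_⟩⟩
  exact (hX.minimal _ htight ⟨hX.mem, hX'.mem⟩ inter_subset_left ⟨haI, haX⟩).2

lemma Extends.trans {I I' I'' : Set α} (hE : M.E = N.E) (h : Extends M N I I')
    (h' : Extends M N I' I'') (hI : CommonIndep M N I) (hI' : CommonIndep M N I') :
    Extends M N I I'' := by
  have hmono := h.heart_subset_heart hE hI hI'
  refine ⟨hmono.trans h'.heart_subset, h.sdiff_subset.trans
    (closure_subset_closure_of_subset_closure fun x hx ↦ ?_)⟩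
  by_cases hx' : x ∈ heart M N I'
  · exact N.mem_closure_of_mem' ⟨h'.heart_subset hx', hx.2⟩ (hI'.right.subset_ground hx.1)
  · exact N.closure_subset_closure (sdiff_subset_sdiff_right hmono)
      (h'.sdiff_subset ⟨hx.1, hx'⟩)

/-- If a finite common independent set `J` spans `I` in `N`, then `I` can be replaced by a set that
keeps a robust part `A` and spans `J`. Take `K` of maximal size among the sets disjoint from `A`
and independent over it in `M` that are `N`-independent, span `I \ A` and are spanned by `J` in `N`;
obstructions to augmenting `K` show that `K ∪ A` is at least as large as `J`. -/
lemma Robust.exists_extension {A I J : Set α} (hE : M.E = N.E) (hA : Robust M N A I) (hAI : A ⊆ I)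
    (hI : CommonIndep M N I) (hJ : CommonIndep M N J) (hIJ : I ⊆ N.closure J) :
    ∃ I', CommonIndep M N I' ∧ A ⊆ I' ∧ I \ A ⊆ N.closure (I' \ A) ∧ J ⊆ N.closure I' := by
  have hAfin := hI.finite.subset hAI
  obtain ⟨K, ⟨hKfin, hKA, hKM, hKN, hIK, hKJ⟩, hmax⟩ := exists_forall_le_of_bounded
    (p := fun K : Set α ↦ K.Finite ∧ Disjoint K A ∧ M.Indep (K ∪ A) ∧ N.Indep K ∧
      I \ A ⊆ N.closure K ∧ K ⊆ N.closure J) ncard J.ncard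
    (fun K hK ↦ hK.2.2.2.1.ncard_le_ncard_of_subset_closure hJ.finite hK.2.2.2.2.2)
    ⟨I \ A, hI.finite.sdiff, disjoint_sdiff_left, by
      rw [sdiff_union_self, union_eq_self_of_subset_right hAI]; exact hI.left,
      hI.right.sdiff _, N.subset_closure _ (sdiff_subset.trans hI.right.subset_ground),
      sdiff_subset.trans hIJ⟩
  have hdiff : (K ∪ A) \ A = K := by rw [union_sdiff_right, hKA.sdiff_eq_left]
  have hKAN : N.Indep (K ∪ A) := by
    refine hKN.union_indep_of_forall_notMem_closure (hAI.trans hI.right.subset_ground)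
      fun t ht htc ↦ ?_
    refine hA (K ∪ A) (hKfin.union hAfin) hKM subset_union_right (by rwa [hdiff]) t ht
      (N.closure_subset_closure ?_ htc)
    rw [union_sdiff_distrib]
    refine union_subset_union_left _ (subset_sdiff_singleton Subset.rfl ?_)
    exact fun h ↦ hKA.le_bot ⟨h, ht⟩
  -- No element of `J` outside the closure of `K` can be gained by augmenting `K` over `(A, ∅)`.
  have hobs : ∀ s : α, ∃ X : Set α, s ∈ J → s ∉ N.closure K → s ∈ X ∧
      X ⊆ M.closure ((K ∩ X) ∪ A) ∧ ∀ v ∈ N.closure K, v ∉ X → v ∈ N.closure (K \ X) := by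
    intro s
    by_cases hs : s ∈ J ∧ s ∉ N.closure K
    · have hsE := hJ.right.subset_ground hs.1
      obtain ⟨K', hfin, hK'A, -, hK'M, hK'N, hsK', hK's⟩ | ⟨X, hsX, hXM, hXN⟩ :=
        exists_augmentation_or_obstruction (M := M) (N := N) (P := A) (Q := ∅) (s := s) hE hKfin
          hKA (disjoint_empty _) hKM (by rwa [union_empty]) hsE
          (by rw [union_empty]; exact hs.2)
      · simp only [union_empty] at hK'N hsK' hK's
        have hsK : s ∉ K := fun h ↦ hs.2 (N.mem_closure_of_mem' h hsE)
        have h1 := ((hKN.notMem_closure_iff_of_notMem hsK hsE).1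
          hs.2).ncard_le_ncard_of_subset_closure hfin hsK'
        rw [ncard_insert_of_notMem hsK hKfin] at h1
        have h2 := hmax K' ⟨hfin, hK'A, hK'M, hK'N, hIK.trans
          (closure_subset_closure_of_subset_closure ((subset_insert _ _).trans hsK')),
          hK's.trans (closure_subset_closure_of_subset_closure (insert_subset
            (N.mem_closure_of_mem' hs.1 hsE) hKJ))⟩
        omega
      · simp only [union_empty] at hXN
        exact ⟨X, fun _ _ ↦ ⟨hsX, hXM, hXN⟩⟩
    · exact ⟨∅, fun h1 h2 ↦ absurd ⟨h1, h2⟩ hs⟩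
  choose X hX using hobs
  set U := ⋃ s ∈ {s | s ∈ J ∧ s ∉ N.closure K}, X s with hU
  have hXU : ∀ s, s ∈ J → s ∉ N.closure K → X s ⊆ U := fun s h1 h2 ↦
    subset_biUnion_of_mem (u := X) (show s ∈ {s | s ∈ J ∧ s ∉ N.closure K} from ⟨h1, h2⟩)
  have hJU : (J ∩ U).ncard ≤ ((K ∩ U) ∪ A).ncard := by
    refine (hJ.left.subset inter_subset_left).ncard_le_ncard_of_subset_closure
      ((hKfin.inter_of_left _).union hAfin) (inter_subset_right.trans ?_)
    refine iUnion₂_subset fun s hs ↦ (hX s hs.1 hs.2).2.1.trans (M.closure_subset_closure ?_)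
    exact union_subset_union_left _ (inter_subset_inter_right _ (hXU s hs.1 hs.2))
  have hJU' : (J \ U).ncard ≤ (K \ U).ncard := by
    refine (hJ.right.subset sdiff_subset).ncard_le_ncard_of_subset_closure hKfin.sdiff ?_
    rintro v ⟨hvJ, hvU⟩
    have hvK : v ∈ N.closure K := by
      by_contra hvK
      exact hvU (hXU v hvJ hvK (hX v hvJ hvK).1)
    by_contra hvn
    obtain ⟨d, -, hdU, hvd, -⟩ := hKN.exists_notMem_closure_sdiff_singleton hvK hvn
    rw [mem_iUnion₂] at hdU
    obtain ⟨s, hs, hds⟩ := hdU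
    refine hvd (N.closure_subset_closure ?_
      ((hX s hs.1 hs.2).2.2 v hvK fun h ↦ hvU (hXU s hs.1 hs.2 h)))
    exact fun x hx ↦ ⟨hx.1, fun h ↦ hx.2 (h ▸ hds)⟩
  have hcard : J.ncard ≤ (K ∪ A).ncard := by
    rw [ncard_union_eq hKA hKfin hAfin]
    have h1 := ncard_union_le (K ∩ U) A
    have h2 := ncard_inter_add_ncard_sdiff_eq_ncard J U hJ.finite
    have h3 := ncard_inter_add_ncard_sdiff_eq_ncard K U hKfin
    omega
  refine ⟨K ∪ A, ⟨hKfin.union hAfin, hKM, hKAN⟩, subset_union_right, by rwa [hdiff],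
    fun s hs ↦ ?_⟩
  by_contra hsn
  have hsE := hJ.right.subset_ground hs
  have hsK : s ∉ K ∪ A := fun h ↦ hsn (N.mem_closure_of_mem' h hsE)
  have h1 := ((hKAN.notMem_closure_iff_of_notMem hsK hsE).1
    hsn).ncard_le_ncard_of_subset_closure hJ.finite
      (insert_subset (N.mem_closure_of_mem' hs hsE) (union_subset hKJ (hAI.trans hIJ)))
  rw [ncard_insert_of_notMem hsK (hKfin.union hAfin)] at h1
  omega

lemma Spannable.exists_finite [N.Finitary] {S : Set α} (hS : S.Finite) (h : Spannable M N S) :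
    ∃ J, CommonIndep M N J ∧ S ⊆ N.closure J := by
  obtain ⟨J, hJ, hSJ⟩ := h
  obtain ⟨J', hJ'J, hfin, hJ', hSJ'⟩ := exists_subset_finite_closure_of_subset_closure hS hSJ
  exact ⟨J', ⟨hfin, hJ.subset hJ'J, hJ'⟩, hSJ'⟩

lemma CommonIndep.exists_extends_of_spannable [N.Finitary] {I : Set α} {b : α} (hE : M.E = N.E)
    (hI : CommonIndep M N I) (hb : Spannable M N (insert b I)) :
    ∃ I', CommonIndep M N I' ∧ Extends M N I I' ∧ b ∈ N.closure I' := by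
  obtain ⟨J, hJ, hbJ⟩ := hb.exists_finite (hI.finite.insert b)
  obtain ⟨I', hI', h1, h2, h3⟩ := (hI.robust_heart hE).exists_extension hE heart_subset hI hJ
    ((subset_insert _ _).trans hbJ)
  exact ⟨I', hI', ⟨h1, h2⟩, closure_subset_closure_of_subset_closure h3 (hbJ (mem_insert _ _))⟩

/-- If `Z` is not spannable, but becomes so together with any single element `e`, then every
element `e` gets into the `M`-closure of the heart of a suitable extension. -/
lemma CommonIndep.exists_extends_mem_closure_heart [N.Finitary] {I Z : Set α} {e : α}
    (hE : M.E = N.E) (hZ : Z.Finite) (hZs : ¬ Spannable M N Z)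
    (he : ∃ J, M.Indep J ∧ Z ⊆ N.closure (insert e J)) (heE : e ∈ M.E)
    (hI : CommonIndep M N I) :
    ∃ I', CommonIndep M N I' ∧ Extends M N I I' ∧ e ∈ M.closure (heart M N I') := by
  obtain ⟨J, hJ, hJfin, hZJ⟩ : ∃ J, M.Indep J ∧ J.Finite ∧ Z ⊆ N.closure (insert e J) := by
    obtain ⟨J, hJ, hZJ⟩ := he
    obtain ⟨L, hL, hLfin, -, hZL⟩ := exists_subset_finite_closure_of_subset_closure hZ hZJ
    refine ⟨J ∩ L, hJ.subset inter_subset_left, hLfin.inter_of_right J,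
      hZL.trans (N.closure_subset_closure fun x hx ↦ ?_)⟩
    exact (hL hx).imp id fun h ↦ ⟨h, hx⟩
  have hLfin := hJfin.insert e
  have hLE : insert e J ⊆ M.E := insert_subset heE hJ.subset_ground
  -- Choose `I'` to span as much of `insert e J` as possible; the rest lies in its obstruction.
  obtain ⟨I', ⟨hI', hII'⟩, hmax⟩ := exists_forall_le_of_bounded
    (p := fun I' ↦ CommonIndep M N I' ∧ Extends M N I I')
    (fun I' ↦ (insert e J ∩ N.closure I').ncard) (insert e J).ncard
    (fun I' _ ↦ ncard_le_ncard inter_subset_left hLfin) ⟨I, hI, hI.extends_refl⟩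
  set X := obstruction M N I' with hXdef
  have hX : ∀ b ∈ insert e J, b ∉ N.closure I' → b ∈ X := by
    intro b hb hbI'
    refine hI'.mem_obstruction hE (hLE hb) fun hs ↦ ?_
    obtain ⟨I'', hI'', h, hbI''⟩ := hI'.exists_extends_of_spannable hE hs
    refine (hmax I'' ⟨hI'', hII'.trans hE h hI hI'⟩).not_gt
      (ncard_lt_ncard ?_ (hLfin.inter_of_left _))
    refine (ssubset_iff_of_subset (inter_subset_inter_right _
      (closure_subset_closure_of_subset_closure (h.subset_closure hI')))).2 ?_
    exact ⟨b, ⟨hb, hbI''⟩, fun h ↦ hbI' h.2⟩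
  refine ⟨I', hI', hII', hI'.obstruction_subset ?_⟩
  by_contra heX
  -- Exchange the part of `I'` in `X` for the part of `J` in `X`.
  refine hZs ⟨(J ∩ X) ∪ (I' \ X), ?_, hZJ.trans (closure_subset_closure_of_subset_closure ?_)⟩
  · refine Indep.union_indep_of_subset_closure (A := I' ∩ X) ?_ ?_ (hJ.subset inter_subset_left)
      (inter_subset_right.trans hI'.obstruction_subset)
    · rw [inter_union_sdiff]; exact hI'.left
    · exact disjoint_sdiff_inter.symm
  · intro l hl
    by_cases hlX : l ∈ X
    · refine N.mem_closure_of_mem' (.inl ⟨hl.resolve_left fun h ↦ heX (h ▸ hlX), hlX⟩) ?_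
      exact hE ▸ hLE hl
    · refine N.closure_subset_closure subset_union_right
        (hI'.tight_obstruction.right l ?_ hlX)
      by_contra h
      exact hlX (hX l hl h)

lemma CommonIndep.exists_extends_subset_closure_heart [N.Finitary] {I Z S : Set α}
    (hE : M.E = N.E) (hZ : Z.Finite) (hZs : ¬ Spannable M N Z)
    (he : ∀ e ∈ M.E, ∃ J, M.Indep J ∧ Z ⊆ N.closure (insert e J)) (hS : S.Finite)
    (hSE : S ⊆ M.E) (hI : CommonIndep M N I) :
    ∃ I', CommonIndep M N I' ∧ Extends M N I I' ∧ S ⊆ M.closure (heart M N I') := by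
  induction S, hS using Set.Finite.induction_on with
  | empty => exact ⟨I, hI, hI.extends_refl, empty_subset _⟩
  | @insert e S _ _ ih =>
    obtain ⟨I₁, hI₁, hII₁, hS₁⟩ := ih ((subset_insert _ _).trans hSE)
    have heE := hSE (mem_insert _ _)
    obtain ⟨I₂, hI₂, hI₁I₂, he₂⟩ :=
      hI₁.exists_extends_mem_closure_heart hE hZ hZs (he e heE) heE
    exact ⟨I₂, hI₂, hII₁.trans hE hI₁I₂ hI hI₁, insert_subset he₂
      (hS₁.trans (M.closure_subset_closure (hI₁I₂.heart_subset_heart hE hI₁ hI₂)))⟩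

/-! ### Safe sets -/

/-- An `M`-independent set `A` is safe if no `M`-independent set `J ⊇ A` spans an element `a ∈ A`
in `N` without using `a`. -/
structure Safe (M N : Matroid α) (A : Set α) : Prop where
  indep : M.Indep A
  notMem_closure : ∀ J, M.Indep J → A ⊆ J → ∀ a ∈ A, a ∉ N.closure (J \ {a})

lemma safe_empty : Safe M N ∅ :=
  ⟨M.empty_indep, by simp⟩

lemma indep_sUnion_of_isChain [M.Finitary] {c : Set (Set α)} (hc : IsChain (· ⊆ ·) c)
    (hne : c.Nonempty) (h : ∀ A ∈ c, M.Indep A) : M.Indep (⋃₀ c) := by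
  refine indep_of_forall_finite_subset_indep _ fun T hT hTfin ↦ ?_
  obtain ⟨A, hA, hTA⟩ := hc.directedOn.exists_mem_subset_of_finite_of_subset_sUnion hne hTfin hT
  exact (h A hA).subset hTA

lemma Safe.sUnion [M.Finitary] {c : Set (Set α)} (hc : IsChain (· ⊆ ·) c) (hne : c.Nonempty)
    (h : ∀ A ∈ c, Safe M N A) : Safe M N (⋃₀ c) := by
  refine ⟨indep_sUnion_of_isChain hc hne fun A hA ↦ (h A hA).indep, fun J hJ hcJ a ha ↦ ?_⟩
  obtain ⟨A, hA, haA⟩ := mem_sUnion.1 ha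
  exact (h A hA).notMem_closure J hJ ((subset_sUnion_of_mem hA).trans hcJ) a haA

/-- If a finite set is not spannable, but becomes so together with any single element, then there
is a nonempty safe set, namely the union of the hearts along a chain of extensions. -/
lemma exists_nonempty_safe_of_critical [M.Finitary] [N.Finitary] {Z : Set α} (hE : M.E = N.E)
    (hM : ∀ e ∈ M.E, M.Indep {e}) (hZ : Z.Finite) (hZE : Z ⊆ M.E) (hZs : ¬ Spannable M N Z)
    (he : ∀ e ∈ M.E, ∃ J, M.Indep J ∧ Z ⊆ N.closure (insert e J)) :
    ∃ A, A.Nonempty ∧ Safe M N A := by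
  obtain ⟨z, hzZ, hz⟩ : ∃ z ∈ Z, z ∉ N.closure ∅ := by
    by_contra! h
    exact hZs ⟨∅, M.empty_indep, h⟩
  have hzE := hZE hzZ
  have hz₀ : CommonIndep M N {z} := ⟨finite_singleton z, hM z hzE, by
    simpa using ((N.empty_indep.notMem_closure_iff (hE ▸ hzE)).1 hz).1⟩
  have hstep : ∀ I : {I // CommonIndep M N I}, ∃ I' : {I // CommonIndep M N I},
      Extends M N I I' ∧ (I : Set α) ⊆ M.closure (heart M N I') := fun I ↦ by
    obtain ⟨I', hI', h⟩ := I.2.exists_extends_subset_closure_heart hE hZ hZs he I.2.finite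
      I.2.left.subset_ground
    exact ⟨⟨I', hI'⟩, h⟩
  choose f hf hfcl using hstep
  set I : ℕ → {I // CommonIndep M N I} := fun n ↦ f^[n] ⟨{z}, hz₀⟩ with hIdef
  have hIsucc : ∀ n, I (n + 1) = f (I n) := fun n ↦ Function.iterate_succ_apply' f n _
  have hmono : Monotone fun n ↦ heart M N (I n : Set α) := monotone_nat_of_le_succ fun n ↦ by
    simp only [hIsucc]
    exact (hf (I n)).heart_subset_heart hE (I n).2 (f (I n)).2
  set A := ⋃ n, heart M N (I n : Set α) with hA
  have hIA : ∀ n, (I n : Set α) ⊆ M.closure A := fun n ↦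
    (hfcl (I n)).trans (M.closure_subset_closure (by
      rw [← hIsucc]
      exact subset_iUnion (fun n ↦ heart M N (I n : Set α)) (n + 1)))
  have hfinA : ∀ S ⊆ A, S.Finite → ∃ n, S ⊆ heart M N (I n : Set α) := fun S hS hSfin ↦ by
    lift S to Finset α using hSfin
    exact hmono.directed_le.exists_mem_subset_of_finset_subset_biUnion hS
  have hAind : M.Indep A := indep_of_forall_finite_subset_indep _ fun S hS hSfin ↦ by
    obtain ⟨n, hn⟩ := hfinA S hS hSfin
    exact (I n).2.left.subset (hn.trans heart_subset)
  refine ⟨A, ?_, hAind, fun J hJ hAJ a ha haJ ↦ ?_⟩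
  · rw [nonempty_iff_ne_empty]
    intro h0
    have hzcl := hIA 0 (show z ∈ ({z} : Set α) from rfl)
    rw [h0] at hzcl
    exact (hM z hzE).notMem_closure_sdiff_of_mem rfl (by simpa using hzcl)
  obtain ⟨T, hTJ, hTfin, -, haT⟩ := exists_mem_finite_closure_of_mem_closure haJ
  obtain ⟨n, hn⟩ := hfinA (insert a (T ∩ A)) (insert_subset ha inter_subset_right)
    ((hTfin.inter_of_left A).insert a)
  have hdisj : Disjoint A (T \ A) := disjoint_sdiff_right
  have hind : M.Indep ((I n : Set α) ∪ (T \ A)) :=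
    (hJ.subset (union_subset hAJ (sdiff_subset.trans (hTJ.trans
      sdiff_subset)))).union_indep_of_subset_closure hdisj (I n).2.left (hIA n)
  refine (I n).2.robust_heart hE _ ((I n).2.finite.union hTfin.sdiff) hind
    (heart_subset.trans subset_union_left) ?_ a (hn (mem_insert _ _))
    (N.closure_subset_closure ?_ haT)
  · exact N.subset_closure_of_subset' (sdiff_subset_sdiff_left subset_union_left)
      (sdiff_subset.trans (I n).2.right.subset_ground)
  · refine fun x hx ↦ ⟨?_, (hTJ hx).2⟩
    by_cases hxA : x ∈ A
    · exact .inl (heart_subset (hn (.inr ⟨hx, hxA⟩)))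
    · exact .inr ⟨hx, hxA⟩

/-- If `M` has no loops and some finite set is not spannable, then there is a nonempty safe set. -/
lemma exists_nonempty_safe [M.Finitary] [N.Finitary] {Z : Set α} (hE : M.E = N.E)
    (hM : ∀ e ∈ M.E, M.Indep {e}) (hZ : Z.Finite) (hZE : Z ⊆ M.E) (hZs : ¬ Spannable M N Z) :
    ∃ A, A.Nonempty ∧ Safe M N A := by
  -- Contract in `N`, and delete from `M`, as much as possible while `Z` stays unspannable.
  obtain ⟨H, -, ⟨hHE, hH⟩, hHmax⟩ := zorn_subset_nonempty
    {H | H ⊆ M.E ∧ ¬ ∃ J, M.Indep J ∧ Z ⊆ N.closure (J ∪ H)} (by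
      refine fun c hcs hc hne ↦ ⟨⋃₀ c, ⟨sUnion_subset fun X hX ↦ (hcs hX).1, ?_⟩,
        fun X hX ↦ subset_sUnion_of_mem hX⟩
      rintro ⟨J, hJ, hZJ⟩
      obtain ⟨L, hL, hLfin, -, hZL⟩ := exists_subset_finite_closure_of_subset_closure hZ hZJ
      obtain ⟨X, hX, hLX⟩ := hc.directedOn.exists_mem_subset_of_finite_of_subset_sUnion hne
        (hLfin.inter_of_left (⋃₀ c)) inter_subset_right
      refine (hcs hX).2 ⟨J, hJ, hZL.trans (N.closure_subset_closure fun x hx ↦ ?_)⟩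
      exact (hL hx).imp id fun h ↦ hLX ⟨hx, h⟩) ∅
    ⟨empty_subset _, by simpa [Spannable] using hZs⟩
  have hRind : ∀ {J}, (M.restrict (M.E \ H)).Indep J ↔ M.Indep J ∧ J ⊆ M.E \ H :=
    restrict_indep_iff
  have hJind : ∀ {J}, M.Indep J → (M.restrict (M.E \ H)).Indep (J \ H) := fun hJ ↦
    hRind.2 ⟨hJ.sdiff _, sdiff_subset_sdiff_left hJ.subset_ground⟩
  have hEq : (M.restrict (M.E \ H)).E = (N.contract H).E := by
    rw [restrict_ground_eq, contract_ground, hE]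
  have hcl : ∀ {J e}, e ∉ H → (e ∈ (N.contract H).closure J ↔ e ∈ N.closure (J ∪ H)) := by
    intro J e heH
    rw [contract_closure_eq, mem_sdiff, and_iff_left heH]
  obtain ⟨A, hAne, hA⟩ := exists_nonempty_safe_of_critical (M := M.restrict (M.E \ H))
    (N := N.contract H) (Z := Z \ H) hEq
    (fun e he ↦ hRind.2 ⟨hM e he.1, singleton_subset_iff.2 he⟩) hZ.sdiff
    (sdiff_subset_sdiff_left hZE)
    (by
      rintro ⟨J, hJ, hZJ⟩
      refine hH ⟨J, (hRind.1 hJ).1, fun z hz ↦ ?_⟩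
      by_cases hzH : z ∈ H
      · exact N.mem_closure_of_mem' (.inr hzH) (hE ▸ hZE hz)
      · exact (hcl hzH).1 (hZJ ⟨hz, hzH⟩))
    (by
      rintro e ⟨heE, heH⟩
      obtain ⟨J, hJ, hZJ⟩ : ∃ J, M.Indep J ∧ Z ⊆ N.closure (J ∪ insert e H) := by
        by_contra hcon
        exact heH (hHmax ⟨insert_subset heE hHE, hcon⟩ (subset_insert _ _) (mem_insert _ _))
      refine ⟨J \ H, hJind hJ, fun z hz ↦ (hcl hz.2).2 (N.closure_subset_closure ?_ (hZJ hz.1))⟩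
      rw [insert_union, sdiff_union_self, union_insert])
  refine ⟨A, hAne, (hRind.1 hA.indep).1, fun J hJ hAJ a ha haJ ↦ ?_⟩
  have hAH : A ⊆ M.E \ H := (hRind.1 hA.indep).2
  refine hA.notMem_closure (J \ H) (hJind hJ) (fun x hx ↦ ⟨hAJ hx, (hAH hx).2⟩) a ha
    ((hcl (hAH ha).2).2 (N.closure_subset_closure ?_ haJ))
  intro x hx
  by_cases hxH : x ∈ H
  · exact .inr hxH
  · exact .inl ⟨⟨hx.1, hxH⟩, hx.2⟩

/-- A safe set of `M / A` and `N`, both restricted to the complement of the `M`-closure of a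
safe set `A`, can be added to `A`. -/
lemma Safe.union {A A' : Set α} (hA : Safe M N A)
    (hE : M.E = N.E) (hA' : Safe ((M.contract A).restrict (M.E \ M.closure A))
      (N.restrict (M.E \ M.closure A)) A') : Safe M N (A ∪ A') := by
  have hind : ∀ {J}, ((M.contract A).restrict (M.E \ M.closure A)).Indep J ↔
      (Disjoint J A ∧ M.Indep (J ∪ A)) ∧ J ⊆ M.E \ M.closure A := by
    intro J
    rw [restrict_indep_iff, hA.indep.contract_indep_iff]
  have hA'i := hind.1 hA'.indep
  refine ⟨by rw [union_comm]; exact hA'i.1.2, fun J hJ hAJ a ha haJ ↦ ?_⟩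
  obtain ha | ha := ha
  · exact hA.notMem_closure J hJ (subset_union_left.trans hAJ) a ha haJ
  have hJA : J \ A ⊆ M.E \ M.closure A := fun x hx ↦ ⟨hJ.subset_ground hx.1, fun hxc ↦
    hJ.notMem_closure_sdiff_of_mem hx.1 (M.closure_subset_closure
      (subset_sdiff_singleton (subset_union_left.trans hAJ) hx.2) hxc)⟩
  have haA : a ∉ A := fun h ↦ hA'i.1.1.le_bot ⟨ha, h⟩
  have hadiff : a ∉ N.closure ((J \ A) \ {a}) := by
    have := hA'.notMem_closure (J \ A)
      (hind.2 ⟨⟨disjoint_sdiff_left, by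
        rwa [sdiff_union_self, union_eq_self_of_subset_right (subset_union_left.trans hAJ)]⟩, hJA⟩)
      (subset_sdiff.2 ⟨subset_union_right.trans hAJ, hA'i.1.1⟩) a ha
    rw [restrict_closure_eq _ (sdiff_subset.trans hJA) (hE ▸ sdiff_subset)] at this
    exact fun h ↦ this ⟨h, hA'i.2 ha⟩
  obtain ⟨B, hB⟩ := N.exists_isBasis' (J \ {a})
  rw [← hB.closure_eq_closure] at haJ
  obtain ⟨d, hdB, hdA, -, hda⟩ := hB.indep.exists_notMem_closure_sdiff_singleton haJ (D := A)
    fun h ↦ hadiff (N.closure_subset_closure (by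
      exact fun x hx ↦ ⟨⟨(hB.subset hx.1).1, hx.2⟩, (hB.subset hx.1).2⟩) h)
  refine hA.notMem_closure J hJ (subset_union_left.trans hAJ) d hdA
    (N.closure_subset_closure ?_ hda)
  refine insert_subset ⟨hAJ (.inr ha), fun h ↦ haA (h ▸ hdA)⟩ ?_
  exact fun x hx ↦ ⟨(hB.subset hx.1).1, hx.2⟩

/-- Outside the `M`-closure of a maximal safe set `A`, every finite set is spannable over `A`. -/
lemma Safe.exists_spanning_of_maximal [M.Finitary] [N.Finitary] {A Z : Set α}
    (hE : M.E = N.E) (hA : Maximal (Safe M N) A) (hZ : Z.Finite)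
    (hZA : Z ⊆ M.E \ M.closure A) :
    ∃ T ⊆ M.E \ M.closure A, M.Indep (A ∪ T) ∧ Z ⊆ N.closure T := by
  by_contra! hcon
  have hind := hA.prop.indep
  have hEq : ((M.contract A).restrict (M.E \ M.closure A)).E =
      (N.restrict (M.E \ M.closure A)).E := rfl
  obtain ⟨A', ⟨a, ha⟩, hA'⟩ := exists_nonempty_safe (Z := Z) hEq
    (fun e he ↦ by
      have heA : e ∉ A := fun h ↦ he.2 (M.mem_closure_of_mem' h he.1)
      rw [restrict_indep_iff, hind.contract_indep_iff, singleton_union]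
      exact ⟨⟨by simpa, (hind.notMem_closure_iff_of_notMem heA he.1).1 he.2⟩, by simpa using he⟩)
    hZ hZA
    (by
      rintro ⟨J, hJ, hZJ⟩
      rw [restrict_indep_iff, hind.contract_indep_iff] at hJ
      rw [restrict_closure_eq _ hJ.2 (hE ▸ sdiff_subset)] at hZJ
      exact hcon J hJ.2 (by rw [union_comm]; exact hJ.1.2) (hZJ.trans inter_subset_left))
  have haA : a ∈ A := hA.le_of_ge (hA.prop.union hE hA') subset_union_left (.inr ha)
  have haE : a ∈ M.E \ M.closure A := hA'.indep.subset_ground ha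
  exact haE.2 (M.mem_closure_of_mem' haA haE.1)

end Matroid

/-! ### From Hall's condition to finite matchability -/

theorem theorem3p1 {α : Type*} (M N : Matroid α) [M.Finitary] [N.Finitary]
    (hE : M.E = N.E) (hHall : M.HallCondition N) : M.FinitelyMatchable N := by
  obtain ⟨A, -, hA⟩ := zorn_subset_nonempty {A | M.Safe N A}
    (fun c hcs hc hne ↦ ⟨⋃₀ c, Matroid.Safe.sUnion hc hne hcs,
      fun X hX ↦ subset_sUnion_of_mem hX⟩) ∅ Matroid.safe_empty
  have hAs : M.Safe N A := hA.prop
  have hAE := hAs.indep.subset_ground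
  set X := M.closure A with hX
  have hXE : X ⊆ M.E := M.closure_subset_ground A
  -- A finite set `L` of elements of `S` and elements outside `X` is spanned by `S ∪ T` for
  -- some `T` that is `M`-independent over `A`.
  have hspan : ∀ {S L : Set α}, L.Finite → L ⊆ S ∪ (M.E \ X) →
      ∃ T ⊆ M.E \ X, M.Indep (A ∪ T) ∧ Disjoint A T ∧ (S ⊆ N.E → L ⊆ N.closure (S ∪ T)) := by
    intro S L hL hLS
    obtain ⟨T, hT, hAT, hLT⟩ := Matroid.Safe.exists_spanning_of_maximal hE hA
      (hL.inter_of_left (M.E \ X)) inter_subset_right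
    refine ⟨T, hT, hAT, ?_, fun hS x hx ↦ ?_⟩
    · exact disjoint_left.2 fun a ha haT ↦ (hT haT).2 (M.mem_closure_of_mem ha)
    · obtain h | h := hLS hx
      · exact N.mem_closure_of_mem' (.inl h) (hS h)
      · exact N.closure_subset_closure subset_union_right (hLT ⟨hx, h⟩)
  have hcontr : N.contractTo X = N.contract (M.E \ X) := by rw [Matroid.contractTo, hE]
  -- `A` is a base of `M` restricted to its closure and is independent of the complement in `N`.
  obtain ⟨B, hBN, hBM⟩ := hHall X hXE ⟨A, hAs.indep.isBasis_closure.restrict_isBase, by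
    rw [hcontr, Matroid.indep_iff_forall_notMem_closure_sdiff']
    refine ⟨fun a ha ↦ ⟨hE ▸ hAE ha, fun h ↦ h.2 (M.mem_closure_of_mem ha)⟩, fun a ha hacl ↦ ?_⟩
    rw [Matroid.contract_closure_eq] at hacl
    obtain ⟨L, hL, hLfin, -, haL⟩ :=
      Matroid.exists_mem_finite_closure_of_mem_closure hacl.1
    obtain ⟨T, hT, hAT, hdisj, hLT⟩ := hspan hLfin hL
    refine hAs.notMem_closure (A ∪ T) hAT subset_union_left a ha (N.closure_subset_closure ?_
      (Matroid.closure_subset_closure_of_subset_closure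
        (hLT (sdiff_subset.trans (hE ▸ hAE))) haL))
    refine union_subset (sdiff_subset_sdiff_left subset_union_left) ?_
    exact subset_sdiff_singleton subset_union_right fun h ↦ hdisj.le_bot ⟨ha, h⟩⟩
  rw [Matroid.restrict_indep_iff] at hBM
  have hBcl : M.E ⊆ N.closure (B ∪ (M.E \ X)) := by
    have hcl := hBN.closure_eq
    rw [hcontr, Matroid.contract_closure_eq, Matroid.contract_ground] at hcl
    intro e he
    by_cases heX : e ∈ M.E \ X
    · exact N.mem_closure_of_mem' (.inr heX) (hE ▸ he)
    · exact (hcl.ge ⟨hE ▸ he, heX⟩).1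
  intro F hF hFfin
  obtain ⟨L, hL, hLfin, -, hFL⟩ :=
    Matroid.exists_subset_finite_closure_of_subset_closure hFfin (hF.trans hBcl)
  obtain ⟨T, hT, hAT, hdisj, hLT⟩ := hspan hLfin hL
  exact ⟨B ∪ T, hAT.union_indep_of_subset_closure hdisj hBM.1 hBM.2, hFL.trans
    (Matroid.closure_subset_closure_of_subset_closure (hLT (hE ▸ hBM.1.subset_ground)))⟩
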